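/- A Nevanlinna function is a holomorphic function $Q:\mathbb C\setminus\mathbb R\to\mathbb C$ with $Q(\bar z)=\overline{Q(z)}$ and $\operatorname{Im}Q(z)/\operatorname{Im}z\ge 0$ for all $z\in\mathbb C\setminus\mathbb R$; it is called nontrivial if it is not identically zero. All identities between such functions are understood on $\mathbb C\setminus\mathbb R$. Let $\alpha,\beta\in\mathbb R$ with $\alpha\ne\beta$, and let $U,V$ be nontrivial Nevanlinna functions. 1. If $U(z)=-\dfrac{(z-\alpha)^2}{(z-\beta)^2}\,V(z)$, then there is $c\in\mathbb R$ with $c(\beta-\alpha)<0$ such that $$U(z)=c\left(1-\frac{\beta-\alpha}{\beta-z}\right),\qquad V(z)=c\left(-1+\frac{\alpha-\beta}{\alpha-z}\right).$$ 2. If $U(z)=-\dfrac{1}{(z-\beta)^2}\,V(z)$, then there is $d>0$ such that $$U(z)=\frac{d}{\beta-z},\qquad V(z)=d(z-\beta).$$ 3. If $U(z)=-(z-\alpha)^2\,V(z)$, then there is $e>0$ such that $$U(z)=e(z-\alpha),\qquad V(z)=\frac{e}{\alpha-z}.$$ Conversely, for all real $c$ with $c(\beta-\alpha)<0$, all $d>0$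 and all $e>0$, the functions $U,V$ given by the formulas in 1, 2 and 3 are Nevanlinna functions, and they satisfy the relation in 1, 2 and 3, respectively. -/

import Mathlib

/-- A (scalar) Nevanlinna function: holomorphic on `ℂ \ ℝ`, symmetric with respect to complex
conjugation, and with `Im Q(z) / Im z ≥ 0` there. Nevanlinna functions live on `ℂ \ ℝ`; the values of
the total function `Q : ℂ → ℂ` at real points play no role. -/
structure IsNevanlinna (Q : ℂ → ℂ) : Prop where
  holomorphic : DifferentiableOn ℂ Q {z : ℂ | z.im ≠ 0}
  symm : ∀ z : ℂ, z.im ≠ 0 → Q (starRingEnd ℂ z) = starRingEnd ℂ (Q z)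
  im_div_im_nonneg : ∀ z : ℂ, z.im ≠ 0 → 0 ≤ (Q z).im / z.im

/-- `Q` is not identically zero on `ℂ \ ℝ`. -/
def IsNontrivial (Q : ℂ → ℂ) : Prop :=
  ∃ z : ℂ, z.im ≠ 0 ∧ Q z ≠ 0

/-- The identity `U = -((z - α)² / (z - β)²) V` on `ℂ \ ℝ`. -/
def RelFiniteFinite (α β : ℝ) (U V : ℂ → ℂ) : Prop :=
  ∀ z : ℂ, z.im ≠ 0 → U z = -((z - α) ^ 2 / (z - β) ^ 2) * V z

/-- The identity `U = -(1 / (z - β)²) V` on `ℂ \ ℝ`. -/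
def RelInftyFinite (β : ℝ) (U V : ℂ → ℂ) : Prop :=
  ∀ z : ℂ, z.im ≠ 0 → U z = -(1 / (z - β) ^ 2) * V z

/-- The identity `U = -(z - α)² V` on `ℂ \ ℝ`. -/
def RelFiniteInfty (α : ℝ) (U V : ℂ → ℂ) : Prop :=
  ∀ z : ℂ, z.im ≠ 0 → U z = -(z - α) ^ 2 * V z

/-- `U = c (1 - (β - α) / (β - z))`, `V = c (-1 + (α - β) / (α - z))` on `ℂ \ ℝ`. -/
def FormFiniteFinite (α β c : ℝ) (U V : ℂ → ℂ) : Prop :=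
  ∀ z : ℂ, z.im ≠ 0 →
    U z = c * (1 - (β - α) / (β - z)) ∧ V z = c * (-1 + (α - β) / (α - z))

/-- `U = d / (β - z)`, `V = d (z - β)` on `ℂ \ ℝ`. -/
def FormInftyFinite (β d : ℝ) (U V : ℂ → ℂ) : Prop :=
  ∀ z : ℂ, z.im ≠ 0 → U z = d / (β - z) ∧ V z = d * (z - β)

/-- `U = e (z - α)`, `V = e / (α - z)` on `ℂ \ ℝ`. -/
def FormFiniteInfty (α e : ℝ) (U V : ℂ → ℂ) : Prop :=
  ∀ z : ℂ, z.im ≠ 0 → U z = e * (z - α) ∧ V z = e / (α - z)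

/-! Each relation reads `U = -m² V` for a Möbius automorphism `m` of the upper half plane: `s (z -
α) / (z - β)` with `s = ±1`, `1 / (β - z)`, or `z - α`. In the coordinate `w = m z` put `f = U / w`.
Then `f w = U` and `f w̄ = -|w|² V`, so positivity of `U` and `V` confines `f` to the sector `|arg
f| ≤ min (arg w, π - arg w)`, up to zeros of `f`. In the coordinate `log w` the argument becomes a
bounded harmonic function on a strip that vanishes at the boundary, hence is zero by
Phragmén–Lindelöf. So `f` is real, hence a constant `c ≥ 0`, and `c > 0` as `U` is nontrivial. Thus
`U = c m` and `V = -c / m`. The converse is read off from partial fractions with nonnegative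
coefficients. -/

/-! ### Rigidity by Phragmén–Lindelöf. -/

open Complex Set in
/-- A holomorphic function on the strip `0 < im ζ < π` whose imaginary part is bounded above, and at
most the distance to the boundary near the boundary, has nonpositive imaginary part. -/
theorem im_nonpos_of_im_le_dist_boundary {h : ℂ → ℂ} {B : ℝ}
    (hd : DifferentiableOn ℂ h (im ⁻¹' Ioo 0 Real.pi))
    (hB : ∀ ζ ∈ im ⁻¹' Ioo 0 Real.pi, (h ζ).im ≤ B)
    (hbdry : ∀ ε : ℝ, 0 < ε → ε < Real.pi / 2 → ∀ ζ : ℂ, ζ.im = ε ∨ ζ.im = Real.pi - ε →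
      (h ζ).im ≤ ε) {ζ : ℂ} (hζ : ζ ∈ im ⁻¹' Ioo 0 Real.pi) : (h ζ).im ≤ 0 := by
  obtain ⟨h0, h1⟩ : 0 < ζ.im ∧ ζ.im < Real.pi := hζ
  have hpi := Real.pi_pos
  have hnorm : ∀ z : ℂ, ‖exp (-I * h z)‖ = Real.exp (h z).im := fun z => by
    rw [norm_exp]; simp
  refine le_of_forall_pos_le_add fun δ hδ => ?_
  obtain ⟨ε, hε, hlt⟩ := exists_between
    (lt_min (lt_min hδ (half_pos hpi)) (lt_min h0 (sub_pos.2 h1)))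
  simp only [lt_min_iff] at hlt
  obtain ⟨⟨hεδ, hεpi⟩, hε0, hε1⟩ := hlt
  have hsub : im ⁻¹' Icc ε (Real.pi - ε) ⊆ im ⁻¹' Ioo 0 Real.pi := fun z hz =>
    ⟨hε.trans_le hz.1, hz.2.trans_lt (by linarith)⟩
  have hdiff : DiffContOnCl ℂ (fun z => exp (-I * h z)) (im ⁻¹' Ioo ε (Real.pi - ε)) := by
    apply DifferentiableOn.diffContOnCl
    rw [closure_preimage_im, closure_Ioo (by linarith)]
    exact ((hd.mono hsub).const_mul _).cexp
  have key := PhragmenLindelof.horizontal_strip (C := Real.exp ε) (z := ζ) hdiff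
    -- Growth exponent `0` suffices, since `B` bounds the imaginary part of `h`.
    ⟨0, div_pos hpi (by linarith), B, by
      refine Asymptotics.IsBigO.of_bound 1 ?_
      refine Filter.mem_inf_of_right fun z hz => ?_
      have hz' : z ∈ im ⁻¹' Ioo 0 Real.pi := hsub ⟨hz.1.le, hz.2.le⟩
      simp only [mem_ofPred_eq, hnorm, zero_mul, Real.exp_zero, mul_one, one_mul, Real.norm_eq_abs,
        Real.abs_exp, Real.exp_le_exp]
      exact hB z hz'⟩
    (fun z hz => by rw [hnorm, Real.exp_le_exp]; exact hbdry ε hε hεpi z (Or.inl hz))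
    (fun z hz => by rw [hnorm, Real.exp_le_exp]; exact hbdry ε hε hεpi z (Or.inr hz))
    hε0.le (by linarith)
  rw [hnorm, Real.exp_le_exp] at key
  linarith

/-- After division by `‖g‖`, the hypothesis says `sin (arg g - y) ≤ 0 ≤ sin (arg g + y)`, where
`|arg g| < π / 2`. -/
theorem abs_arg_le_of_abs_im_mul_cos_le {g : ℂ} {y : ℝ} (hg : 0 < g.re) (hy : 0 < y)
    (h : |g.im * Real.cos y| ≤ g.re * Real.sin y) : |g.arg| ≤ y := by
  have hn : 0 < ‖g‖ := hg.trans_le (Complex.re_le_norm g)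
  have harg := abs_lt.1 (Complex.abs_arg_lt_pi_div_two_iff.2 (Or.inl hg))
  rw [← Complex.norm_mul_cos_arg g, ← Complex.norm_mul_sin_arg g, abs_le] at h
  have h1 : Real.sin g.arg * Real.cos y - Real.cos g.arg * Real.sin y ≤ 0 :=
    nonpos_of_mul_nonpos_right (a := ‖g‖) (by linarith [h.2]) hn
  have h2 : 0 ≤ Real.sin g.arg * Real.cos y + Real.cos g.arg * Real.sin y :=
    nonneg_of_mul_nonneg_right (a := ‖g‖) (by linarith [h.1]) hn
  rw [← Real.sin_sub] at h1
  rw [← Real.sin_add] at h2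
  rw [abs_le]
  constructor
  · by_contra! hlt
    exact absurd h2 (not_le.2 (Real.sin_neg_of_neg_of_neg_pi_lt (by linarith) (by linarith)))
  · by_contra! hlt
    exact absurd h1 (not_le.2 (Real.sin_pos_of_pos_of_lt_pi (by linarith) (by linarith)))

open Complex Set in
/-- If `f w * w` has nonnegative and `f w / w` nonpositive imaginary part on the upper half plane,
then the holomorphic function `f` is a nonnegative constant there. -/
theorem exists_eq_const_of_im_mul_nonneg_of_im_mul_conj_nonpos {f : ℂ → ℂ}
    (hf : DifferentiableOn ℂ f {w | 0 < w.im})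
    (h1 : ∀ w : ℂ, 0 < w.im → 0 ≤ (f w * w).im)
    (h2 : ∀ w : ℂ, 0 < w.im → (f w * starRingEnd ℂ w).im ≤ 0) :
    ∃ c : ℝ, 0 ≤ c ∧ ∀ w : ℂ, 0 < w.im → f w = c := by
  simp only [mul_im, conj_re, conj_im] at h1 h2
  have hre : ∀ w : ℂ, 0 < w.im → 0 ≤ (f w).re := fun w hw =>
    nonneg_of_mul_nonneg_left (b := w.im) (by linarith [h1 w hw, h2 w hw]) hw
  have hpos : ∀ w : ℂ, 0 < w.im → 0 < (f w + 1).re := fun w hw => by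
    simpa using add_pos_of_nonneg_of_pos (hre w hw) one_pos
  have himexp : ∀ ζ ∈ im ⁻¹' Ioo 0 Real.pi, 0 < (exp ζ).im := fun ζ hζ => by
    rw [exp_im]; exact mul_pos (Real.exp_pos _) (Real.sin_pos_of_mem_Ioo hζ)
  -- `f` may vanish; adding `1` moves it into the open right half plane, where `log` is holomorphic,
  -- and keeps it in the sector.
  set h : ℂ → ℂ := fun ζ => log (f (exp ζ) + 1) with hdef
  have hd : DifferentiableOn ℂ h (im ⁻¹' Ioo 0 Real.pi) := by
    refine DifferentiableOn.clog ((hf.comp differentiable_exp.differentiableOn himexp).add_const 1)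
      fun ζ hζ => Or.inl (hpos _ (himexp ζ hζ))
  have hB : ∀ ζ, |(h ζ).im| ≤ Real.pi := fun ζ => by
    rw [hdef, log_im]; exact abs_arg_le_pi _
  have hbdry : ∀ ε : ℝ, 0 < ε → ε < Real.pi / 2 → ∀ ζ : ℂ, ζ.im = ε ∨ ζ.im = Real.pi - ε →
      |(h ζ).im| ≤ ε := by
    intro ε hε hε2 ζ hζ
    have hmem : ζ ∈ im ⁻¹' Ioo 0 Real.pi := by
      rcases hζ with hζ | hζ <;> simp only [mem_preimage, mem_Ioo, hζ] <;> constructor <;> linarith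
    have hw := himexp ζ hmem
    rw [hdef, log_im]
    refine abs_arg_le_of_abs_im_mul_cos_le (hpos _ hw) hε ?_
    have hsin : Real.sin ζ.im = Real.sin ε := by rcases hζ with hζ | hζ <;> simp [hζ]
    have hcos : Real.cos ζ.im = Real.cos ε ∨ Real.cos ζ.im = -Real.cos ε := by
      rcases hζ with hζ | hζ <;> simp [hζ]
    have e1 := h1 _ hw
    have e2 := h2 _ hw
    have hs : 0 < Real.sin ε := Real.sin_pos_of_pos_of_lt_pi hε (by linarith)
    have habs : |(f (exp ζ)).im * Real.cos ζ.im| ≤ (f (exp ζ)).re * Real.sin ε := by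
      rw [exp_re, exp_im, hsin] at e1 e2
      have hr := Real.exp_pos ζ.re
      rw [abs_le]
      constructor <;> refine le_of_mul_le_mul_left ?_ hr <;> linarith
    have habs' : |(f (exp ζ)).im * Real.cos ζ.im| = |(f (exp ζ)).im * Real.cos ε| := by
      rcases hcos with hc | hc <;> simp [hc, abs_mul]
    rw [habs'] at habs
    simp only [add_im, one_im, add_zero, add_re, one_re]
    linarith
  have him : ∀ w : ℂ, 0 < w.im → (f w).im = 0 := by
    intro w hw
    have hw0 : w ≠ 0 := by rintro rfl; simp at hw
    have hmem : log w ∈ im ⁻¹' Ioo 0 Real.pi := by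
      rw [mem_preimage, log_im]
      have hne : w.arg ≠ Real.pi := fun h => hw.ne' (arg_eq_pi_iff.1 h).2
      have hne0 : w.arg ≠ 0 := fun h => hw.ne' (arg_eq_zero_iff.1 h).2
      exact ⟨(arg_nonneg_iff.2 hw.le).lt_of_ne' hne0, (arg_le_pi w).lt_of_ne hne⟩
    have le1 := im_nonpos_of_im_le_dist_boundary hd (fun ζ _ => (le_abs_self _).trans (hB ζ))
      (fun ε a b ζ c => (le_abs_self _).trans (hbdry ε a b ζ c)) hmem
    have le2 := im_nonpos_of_im_le_dist_boundary (h := fun ζ => -h ζ) hd.neg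
      (fun ζ _ => by rw [neg_im]; exact (neg_le_abs _).trans (hB ζ))
      (fun ε a b ζ c => by rw [neg_im]; exact (neg_le_abs _).trans (hbdry ε a b ζ c)) hmem
    have harg : (f w + 1).arg = 0 := by
      rw [neg_im] at le2
      simp only [hdef, exp_log hw0, log_im] at le1 le2
      linarith
    simpa using (arg_eq_zero_iff.1 harg).2
  have hopen : IsOpen {w : ℂ | 0 < w.im} := isOpen_lt continuous_const continuous_im
  obtain ⟨c, hc⟩ := (hf.analyticOnNhd hopen).eq_const_of_im_eq_const (c₀ := 0) him hopen
    ⟨⟨I, by simp⟩, (convex_halfSpace_im_gt 0).isPreconnected⟩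
  have hcI : f I = c := hc I (by simp)
  have hcim : c.im = 0 := by rw [← hcI]; exact him I (by simp)
  refine ⟨c.re, by rw [← hcI]; exact hre I (by simp), fun w hw => ?_⟩
  rw [hc w hw]
  exact Complex.ext rfl (by simpa using hcim)

/-! ### Nevanlinna functions related by a Möbius map. -/

theorem IsNevanlinna.im_nonneg {Q : ℂ → ℂ} (hQ : IsNevanlinna Q) {z : ℂ} (hz : 0 < z.im) :
    0 ≤ (Q z).im := by
  have := mul_nonneg (hQ.im_div_im_nonneg z hz.ne') hz.le
  rwa [div_mul_cancel₀ _ hz.ne'] at this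

/-- It suffices to check a Nevanlinna function on the upper half plane. -/
theorem IsNevanlinna.of_im_nonneg {Q : ℂ → ℂ} (hd : DifferentiableOn ℂ Q {z : ℂ | z.im ≠ 0})
    (hs : ∀ z : ℂ, z.im ≠ 0 → Q (starRingEnd ℂ z) = starRingEnd ℂ (Q z))
    (hp : ∀ z : ℂ, 0 < z.im → 0 ≤ (Q z).im) : IsNevanlinna Q := by
  refine ⟨hd, hs, fun z hz => ?_⟩
  rcases lt_or_gt_of_ne hz with h | h
  · have := hp (starRingEnd ℂ z) (by simpa using h)
    rw [hs z hz, Complex.conj_im] at this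
    exact div_nonneg_of_nonpos (by linarith) h.le
  · exact div_nonneg (hp z h) h.le

/-- If `U = -m² V` for Nevanlinna functions `U`, `V` and a self-map `m` of the upper half plane with
holomorphic inverse `n`, then `U` is a positive multiple of `m`. -/
theorem exists_eq_mul_of_eq_neg_sq_mul {U V m n : ℂ → ℂ} (hU : IsNevanlinna U)
    (hU0 : IsNontrivial U) (hV : IsNevanlinna V)
    (hm : ∀ z : ℂ, 0 < z.im → 0 < (m z).im)
    (hn : ∀ w : ℂ, 0 < w.im → 0 < (n w).im)
    (hnd : DifferentiableOn ℂ n {w | 0 < w.im})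
    (hmn : ∀ w : ℂ, 0 < w.im → m (n w) = w) (hnm : ∀ z : ℂ, 0 < z.im → n (m z) = z)
    (hsymm : ∀ z : ℂ, m (starRingEnd ℂ z) = starRingEnd ℂ (m z))
    (hUV : ∀ z : ℂ, z.im ≠ 0 → U z = -(m z) ^ 2 * V z) :
    ∃ c : ℝ, 0 < c ∧ ∀ z : ℂ, z.im ≠ 0 → U z = c * m z ∧ V z = -(c / m z) := by
  have hne : ∀ w : ℂ, 0 < w.im → w ≠ 0 := by rintro w hw rfl; simp at hw
  have hd : DifferentiableOn ℂ (fun w => U (n w) / w) {w | 0 < w.im} :=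
    (hU.holomorphic.comp hnd fun w hw => (hn w hw).ne').div differentiableOn_id
      fun w hw => hne w hw
  obtain ⟨c, hc0, hc⟩ := exists_eq_const_of_im_mul_nonneg_of_im_mul_conj_nonpos hd
    (fun w hw => by
      rw [div_mul_cancel₀ _ (hne w hw)]
      exact hU.im_nonneg (hn w hw))
    (fun w hw => by
      have e : U (n w) / w * starRingEnd ℂ w = -((Complex.normSq w : ℝ) * V (n w)) := by
        rw [hUV _ (hn w hw).ne', hmn w hw, Complex.normSq_eq_conj_mul_self]
        field_simp [hne w hw]
      rw [e, Complex.neg_im, Complex.im_ofReal_mul]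
      exact neg_nonpos.2 (mul_nonneg (Complex.normSq_nonneg w) (hV.im_nonneg (hn w hw))))
  have hup : ∀ z : ℂ, 0 < z.im → U z = c * m z := fun z hz => by
    have := hc (m z) (hm z hz)
    rwa [hnm z hz, div_eq_iff (hne _ (hm z hz))] at this
  have hall : ∀ z : ℂ, z.im ≠ 0 → U z = c * m z ∧ m z ≠ 0 := fun z hz => by
    rcases lt_or_gt_of_ne hz with h | h
    · have hz' : 0 < (starRingEnd ℂ z).im := by simpa using h
      refine ⟨?_, fun h0 => hne _ (hm _ hz') (by rw [hsymm, h0, map_zero])⟩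
      have := hup _ hz'
      rw [hU.symm z hz, hsymm] at this
      simpa using congrArg (starRingEnd ℂ) this
    · exact ⟨hup z h, hne _ (hm z h)⟩
  refine ⟨c, hc0.lt_of_ne' ?_, fun z hz => ⟨(hall z hz).1, ?_⟩⟩
  · rintro rfl
    obtain ⟨z, hz, h⟩ := hU0
    exact h (by simpa using (hall z hz).1)
  · obtain ⟨e, h0⟩ := hall z hz
    rw [hUV z hz] at e
    rw [← neg_div, eq_div_iff h0]
    apply mul_left_cancel₀ h0
    linear_combination -e

/-! ### The explicit forms. -/

theorem sub_ofReal_ne_zero {z : ℂ} (hz : z.im ≠ 0) (a : ℝ) : z - a ≠ 0 := fun h =>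
  hz (by simpa using congrArg Complex.im h)

theorem ofReal_sub_ne_zero {z : ℂ} (hz : z.im ≠ 0) (a : ℝ) : (a : ℂ) - z ≠ 0 := fun h =>
  hz (by simpa using congrArg Complex.im h)

theorem inv_ofReal_sub_im_pos {z : ℂ} (hz : 0 < z.im) (a : ℝ) : 0 < ((a - z : ℂ)⁻¹).im := by
  rw [Complex.inv_im]
  exact div_pos (by simpa using hz) (Complex.normSq_pos.2 (ofReal_sub_ne_zero hz.ne' a))

theorem isNevanlinna_of_eq_add_mul_inv {Q : ℂ → ℂ} {a b p : ℝ} (hb : 0 ≤ b)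
    (h : ∀ z : ℂ, z.im ≠ 0 → Q z = a + b * (p - z)⁻¹) : IsNevanlinna Q := by
  refine .of_im_nonneg ?_ (fun z hz => ?_) fun z hz => ?_
  · refine DifferentiableOn.congr ?_ h
    exact (((differentiableOn_id.const_sub _).inv
      fun z hz => ofReal_sub_ne_zero hz p).const_mul _).const_add _
  · rw [h z hz, h _ (by simpa using hz)]
    simp
  · rw [h z hz.ne']
    simpa using mul_nonneg hb (inv_ofReal_sub_im_pos hz p).le

theorem isNevanlinna_of_eq_mul_sub {Q : ℂ → ℂ} {b p : ℝ} (hb : 0 ≤ b)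
    (h : ∀ z : ℂ, z.im ≠ 0 → Q z = b * (z - p)) : IsNevanlinna Q := by
  refine .of_im_nonneg ?_ (fun z hz => ?_) fun z hz => ?_
  · exact DifferentiableOn.congr ((differentiableOn_id.sub_const _).const_mul _) h
  · rw [h z hz, h _ (by simpa using hz)]
    simp
  · rw [h z hz.ne']
    simpa using mul_nonneg hb hz.le

theorem exists_formInftyFinite {β : ℝ} {U V : ℂ → ℂ} (hU : IsNevanlinna U)
    (hU0 : IsNontrivial U) (hV : IsNevanlinna V) (h : RelInftyFinite β U V) :
    ∃ d : ℝ, 0 < d ∧ FormInftyFinite β d U V := by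
  have hinv : ∀ w : ℂ, 0 < w.im → 0 < ((β : ℂ) - w⁻¹).im := fun w hw => by
    simpa [Complex.inv_im, neg_div] using
      div_pos hw (Complex.normSq_pos.2 (by rintro rfl; simp at hw))
  obtain ⟨d, hd, hform⟩ := exists_eq_mul_of_eq_neg_sq_mul (m := fun z => (β - z)⁻¹)
    (n := fun w => β - w⁻¹) hU hU0 hV (fun z hz => inv_ofReal_sub_im_pos hz β) hinv
    ((differentiableOn_id.inv fun w hw => by rintro rfl; simp at hw).const_sub _)
    (fun w _ => by simp) (fun z _ => by simp) (fun z => by simp)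
    (fun z hz => by rw [h z hz, inv_pow, one_div, sub_sq_comm])
  refine ⟨d, hd, fun z hz => ⟨by rw [(hform z hz).1, div_eq_mul_inv], ?_⟩⟩
  rw [(hform z hz).2, div_inv_eq_mul]
  ring

theorem exists_formFiniteInfty {α : ℝ} {U V : ℂ → ℂ} (hU : IsNevanlinna U)
    (hU0 : IsNontrivial U) (hV : IsNevanlinna V) (h : RelFiniteInfty α U V) :
    ∃ e : ℝ, 0 < e ∧ FormFiniteInfty α e U V := by
  obtain ⟨e, he, hform⟩ := exists_eq_mul_of_eq_neg_sq_mul (m := fun z => z - α)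
    (n := fun w => w + α) hU hU0 hV (fun z hz => by simpa using hz) (fun z hz => by simpa using hz)
    (differentiableOn_id.add_const _) (fun w _ => by simp) (fun z _ => by simp)
    (fun z => by simp) h
  refine ⟨e, he, fun z hz => ⟨(hform z hz).1, ?_⟩⟩
  rw [(hform z hz).2, ← div_neg, neg_sub]

theorem exists_formFiniteFinite {α β : ℝ} (hαβ : α ≠ β) {U V : ℂ → ℂ} (hU : IsNevanlinna U)
    (hU0 : IsNontrivial U) (hV : IsNevanlinna V) (h : RelFiniteFinite α β U V) :
    ∃ c : ℝ, c * (β - α) < 0 ∧ FormFiniteFinite α β c U V := by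
  -- `s` is the sign of `α - β`: it makes `m` preserve the upper half plane, and `s² = 1` keeps `m²`
  -- unchanged.
  obtain ⟨s, hs2, hs⟩ : ∃ s : ℝ, s ^ 2 = 1 ∧ 0 < s * (α - β) := by
    rcases lt_or_gt_of_ne hαβ with h | h
    · exact ⟨-1, by norm_num, by linarith⟩
    · exact ⟨1, by norm_num, by linarith⟩
  have hs0 : (s : ℂ) ≠ 0 := by
    rintro h0
    rw [Complex.ofReal_eq_zero] at h0
    simp [h0] at hs
  have hs2' : (s : ℂ) ^ 2 = 1 := by exact_mod_cast hs2
  have hab : (α : ℂ) - β ≠ 0 := sub_ne_zero.2 (by exact_mod_cast hαβ)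
  have hmeq : ∀ z : ℂ, z.im ≠ 0 →
      s * (z - α) / (z - β) = (s : ℝ) + ((s * (α - β) : ℝ) : ℂ) * (β - z)⁻¹ := fun z hz => by
    have h1 := sub_ofReal_ne_zero hz β
    have h2 := ofReal_sub_ne_zero hz β
    push_cast
    field_simp
    ring
  have hneq : ∀ w : ℂ, w.im ≠ 0 →
      (w * β - s * α) / (w - s) = (β : ℝ) + ((s * (α - β) : ℝ) : ℂ) * (s - w)⁻¹ := fun w hw => by
    have h1 := sub_ofReal_ne_zero hw s
    have h2 := ofReal_sub_ne_zero hw s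
    push_cast
    field_simp
    ring
  have him : ∀ (a b p : ℝ) (z : ℂ), 0 < b → 0 < z.im → 0 < (a + b * (p - z)⁻¹ : ℂ).im :=
    fun a b p z hb hz => by
      rw [Complex.add_im, Complex.im_ofReal_mul, Complex.ofReal_im, zero_add]
      exact mul_pos hb (inv_ofReal_sub_im_pos hz p)
  obtain ⟨c, hc, hform⟩ := exists_eq_mul_of_eq_neg_sq_mul (m := fun z => s * (z - α) / (z - β))
    (n := fun w => (w * β - s * α) / (w - s)) hU hU0 hV
    (fun z hz => by rw [hmeq z hz.ne']; exact him _ _ _ z hs hz)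
    (fun w hw => by rw [hneq w hw.ne']; exact him _ _ _ w hs hw)
    (((differentiableOn_id.mul_const _).sub_const _).div (differentiableOn_id.sub_const _)
      fun w hw => sub_ofReal_ne_zero (ne_of_gt hw) s)
    (fun w hw => by
      have h1 := sub_ofReal_ne_zero hw.ne' s
      have e1 : (w * β - s * α) / (w - s) - α = w * (β - α) / (w - s) := by
        field_simp; ring
      have e2 : (w * β - s * α) / (w - s) - β = s * (β - α) / (w - s) := by
        field_simp; ring
      have hba : (β : ℂ) - α ≠ 0 := by rw [← neg_sub]; exact neg_ne_zero.2 hab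
      simp only [e1, e2]
      field_simp)
    (fun z hz => by
      have h1 := sub_ofReal_ne_zero hz.ne' β
      have e1 : s * (z - α) / (z - β) - s = s * (β - α) / (z - β) := by
        field_simp; ring
      have e2 : s * (z - α) / (z - β) * β - s * α = z * (s * (β - α)) / (z - β) := by
        field_simp; ring
      have hba : (β : ℂ) - α ≠ 0 := by rw [← neg_sub]; exact neg_ne_zero.2 hab
      simp only [e1, e2]
      field_simp)
    (fun z => by simp)
    (fun z hz => by rw [h z hz, div_pow, mul_pow, hs2', one_mul])
  -- The constant absorbs the sign: `c s (β - α) = -c · s (α - β) < 0`.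
  refine ⟨c * s, by nlinarith [mul_pos hc hs], fun z hz => ?_⟩
  have h1 := sub_ofReal_ne_zero hz β
  have h2 := ofReal_sub_ne_zero hz β
  have h3 := sub_ofReal_ne_zero hz α
  have h4 := ofReal_sub_ne_zero hz α
  constructor
  · rw [(hform z hz).1]
    push_cast
    field_simp
    ring
  · rw [(hform z hz).2]
    push_cast
    field_simp
    rw [hs2']
    ring

theorem lemma6p2 (α β : ℝ) (hαβ : α ≠ β) (U V : ℂ → ℂ) :
    -- the three relations force the three forms, respectively
    (IsNevanlinna U → IsNontrivial U → IsNevanlinna V → IsNontrivial V →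
      (RelFiniteFinite α β U V → ∃ c : ℝ, c * (β - α) < 0 ∧ FormFiniteFinite α β c U V) ∧
      (RelInftyFinite β U V → ∃ d : ℝ, 0 < d ∧ FormInftyFinite β d U V) ∧
      (RelFiniteInfty α U V → ∃ e : ℝ, 0 < e ∧ FormFiniteInfty α e U V)) ∧
    -- conversely, all functions of these forms are Nevanlinna and satisfy the relations
    (∀ c : ℝ, c * (β - α) < 0 → FormFiniteFinite α β c U V →
      IsNevanlinna U ∧ IsNevanlinna V ∧ RelFiniteFinite α β U V) ∧
    (∀ d : ℝ, 0 < d → FormInftyFinite β d U V →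
      IsNevanlinna U ∧ IsNevanlinna V ∧ RelInftyFinite β U V) ∧
    (∀ e : ℝ, 0 < e → FormFiniteInfty α e U V →
      IsNevanlinna U ∧ IsNevanlinna V ∧ RelFiniteInfty α U V) := by
  refine ⟨fun hU hU0 hV _ => ⟨exists_formFiniteFinite hαβ hU hU0 hV,
    exists_formInftyFinite hU hU0 hV, exists_formFiniteInfty hU hU0 hV⟩, ?_, ?_, ?_⟩
  · refine fun c hc h => ⟨isNevanlinna_of_eq_add_mul_inv (a := c) (b := -(c * (β - α))) (p := β)
      (by linarith) fun z hz => ?_, isNevanlinna_of_eq_add_mul_inv (a := -c)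
      (b := -(c * (β - α))) (p := α) (by linarith) fun z hz => ?_, fun z hz => ?_⟩
    · rw [(h z hz).1]; push_cast; ring
    · rw [(h z hz).2]; push_cast; ring
    · have h1 := sub_ofReal_ne_zero hz β
      have h2 := ofReal_sub_ne_zero hz β
      have h4 := ofReal_sub_ne_zero hz α
      rw [(h z hz).1, (h z hz).2]
      field_simp
      ring
  · refine fun d hd h => ⟨isNevanlinna_of_eq_add_mul_inv (a := 0) (b := d) (p := β) hd.le
      fun z hz => ?_, isNevanlinna_of_eq_mul_sub hd.le fun z hz => (h z hz).2, fun z hz => ?_⟩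
    · rw [(h z hz).1]; push_cast; ring
    · have h1 := sub_ofReal_ne_zero hz β
      have h2 := ofReal_sub_ne_zero hz β
      rw [(h z hz).1, (h z hz).2]
      field_simp
      ring
  · refine fun e he h => ⟨isNevanlinna_of_eq_mul_sub he.le fun z hz => (h z hz).1,
      isNevanlinna_of_eq_add_mul_inv (a := 0) (b := e) (p := α) he.le fun z hz => ?_,
      fun z hz => ?_⟩
    · rw [(h z hz).2]; push_cast; ring
    · have h4 := ofReal_sub_ne_zero hz α
      rw [(h z hz).1, (h z hz).2]
      field_simp
      ring
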